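/- A \emph{monotonic counter machine} is a tuple $\mathcal{C}=\langle S,C,\Delta\rangle$, where $S$ is a finite set of states, $C=\{c_1,\dots,c_n\}$ is a finite set of counters, and $\Delta\subseteq S\times\Phi(C)\times \mathrm{Op}(C)\times S$ is a finite set of edges. Here the guards $\Phi(C)$ are given by $\varphi ::= \mathrm{true}\mid c<k\mid c=k\mid c>k\mid \varphi\wedge\varphi$ with $c\in C$, $k\in\mathbb{Z}$, and the operations are $\mathrm{Op}(C)=\{\mathit{reset}(c),\mathit{inc}(c): c\in C\}\cup\{\mathit{nop}\}$. Configurations are pairs $\langle s,\upsilon\rangle\in S\times\mathbb{N}^n$. There is a transition $\langle s,\upsilon\rangle\to\langle s',\upsilon'\rangle$ if some edge $\langle s,\varphi,\mathit{op},s'\rangle\in\Delta$ satisfies $\upsilon\models\varphi$ and $\upsilon'$ is obtained from $\upsilon$ by performing $\mathit{op}$: set counter $c_i$ to $0$ for $\mathit{reset}(c_i)$, add $1$ to $c_i$ for $\mathit{inc}(c_i)$, change nothing for $\mathit{nop}$. Let $\to^*$ be the reflexive transitive closure of $\to$. Presburger arithmetic is the first-order language interpreted over $\mathbb{Z}$ with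 terms $t::=c\mid z\mid t+t\mid t-t$ ($c\in\mathbb{Z}$, $z$ a variable) and atomic formulas $t\le t'$ and $t\equiv t'\pmod m$ ($m\in\mathbb{Z}$). Its existential fragment consists of the formulas $\exists z_1\cdots\exists z_k\,\psi$ with $\psi$ quantifier-free. The size $|\mathcal{C}|$ is the number of counters plus the number of states plus the total length of all edges; the size of a formula is its length. Integer constants are written in binary in both. \textbf{Proposition.} There is a polynomial $p$ such that for every $n\ge 0$, every monotonic counter machine $\mathcal{C}$ with $n$ counters, and all states $s,s'$ of $\mathcal{C}$, the reachability relation \[ \{\langle\upsilon,\upsilon'\rangle\in\mathbb{N}^{2n} : \langle s,\upsilon\rangle\to^*\langle s',\upsilon'\rangle\} \] is defined, as a subset of $\mathbb{Z}^{2n}$, by a formula with $2n$ free variables in the existential fragment of Presburger arithmetic, of size at most $2^{p(|\mathcal{C}|)}$. -/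

import Mathlib

/-! ### Presburger arithmetic over the integers -/

namespace PresburgerZ

/-- Number of bits used to write an integer in binary (a sign bit and the binary digits). -/
def intBits (k : ℤ) : ℕ := 1 + Nat.size k.natAbs

/-- Terms `t ::= c | z | t + t | t - t` of integer sort, with `c ∈ ℤ` and with variables among
`z_0, …, z_{k-1}`. -/
inductive Term (k : ℕ) : Type
  | const (c : ℤ) : Term k
  | var (i : Fin k) : Term k
  | add (t u : Term k) : Term k
  | sub (t u : Term k) : Term k

/-- The value of a term in `ℤ`. -/
def Term.eval {k : ℕ} (x : Fin k → ℤ) : Term k → ℤ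
  | .const c => c
  | .var i => x i
  | .add t u => t.eval x + u.eval x
  | .sub t u => t.eval x - u.eval x

/-- The length of a term; constants and indices of variables are written in binary. -/
def Term.size {k : ℕ} : Term k → ℕ
  | .const c => intBits c
  | .var i => 1 + Nat.size i
  | .add t u => 1 + t.size + u.size
  | .sub t u => 1 + t.size + u.size

/-- Formulas of Presburger arithmetic with free variables among `z_0, …, z_{k-1}`. The atomic
formulas are `t ≤ u` and `t ≡ u (mod m)`. A quantifier binds the variable with the next free
index `k`. -/
inductive Formula : ℕ → Type
  | le {k : ℕ} (t u : Term k) : Formula k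
  | modEq {k : ℕ} (m : ℤ) (t u : Term k) : Formula k
  | not {k : ℕ} (φ : Formula k) : Formula k
  | and {k : ℕ} (φ ψ : Formula k) : Formula k
  | or {k : ℕ} (φ ψ : Formula k) : Formula k
  | ex {k : ℕ} (φ : Formula (k + 1)) : Formula k
  | all {k : ℕ} (φ : Formula (k + 1)) : Formula k

/-- Satisfaction in the structure `ℤ`. -/
def Formula.Holds : {k : ℕ} → Formula k → (Fin k → ℤ) → Prop
  | _, .le t u, x => t.eval x ≤ u.eval x
  | _, .modEq m t u, x => t.eval x ≡ u.eval x [ZMOD m]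
  | _, .not φ, x => ¬ φ.Holds x
  | _, .and φ ψ, x => φ.Holds x ∧ ψ.Holds x
  | _, .or φ ψ, x => φ.Holds x ∨ ψ.Holds x
  | _, .ex φ, x => ∃ a : ℤ, φ.Holds (Fin.snoc x a)
  | _, .all φ, x => ∀ a : ℤ, φ.Holds (Fin.snoc x a)

/-- The length of a formula; integers and indices of variables are written in binary. -/
def Formula.size : {k : ℕ} → Formula k → ℕ
  | _, .le t u => 1 + t.size + u.size
  | _, .modEq m t u => 1 + intBits m + t.size + u.size
  | _, .not φ => 1 + φ.size
  | _, .and φ ψ => 1 + φ.size + ψ.size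
  | _, .or φ ψ => 1 + φ.size + ψ.size
  | k, .ex φ => 2 + Nat.size k + φ.size
  | k, .all φ => 2 + Nat.size k + φ.size

/-- Quantifier-free formulas. -/
inductive Formula.IsQF : {k : ℕ} → Formula k → Prop
  | le {k : ℕ} (t u : Term k) : IsQF (Formula.le t u)
  | modEq {k : ℕ} (m : ℤ) (t u : Term k) : IsQF (Formula.modEq m t u)
  | not {k : ℕ} {φ : Formula k} : IsQF φ → IsQF (Formula.not φ)
  | and {k : ℕ} {φ ψ : Formula k} : IsQF φ → IsQF ψ → IsQF (Formula.and φ ψ)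
  | or {k : ℕ} {φ ψ : Formula k} : IsQF φ → IsQF ψ → IsQF (Formula.or φ ψ)

/-- The existential fragment: formulas `∃ z_k ⋯ ∃ z_{k+m-1}, φ` with `φ` quantifier-free. -/
inductive Formula.IsExistential : {k : ℕ} → Formula k → Prop
  | of_isQF {k : ℕ} {φ : Formula k} : φ.IsQF → IsExistential φ
  | ex {k : ℕ} {φ : Formula (k + 1)} : IsExistential φ → IsExistential (Formula.ex φ)

/-- The formula `φ` with `k` free variables defines the set `A ⊆ ℕ^k`, regarded as a subset of
`ℤ^k`. -/
def Formula.Defines {k : ℕ} (φ : Formula k) (A : Set (Fin k → ℕ)) : Prop :=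
  ∀ x : Fin k → ℤ, φ.Holds x ↔ ∃ v ∈ A, ∀ i, x i = (v i : ℤ)

end PresburgerZ

/-! ### Monotonic counter machines -/

namespace MonotonicCM

/-- Guards over the counters `c_0, …, c_{n-1}`:
`φ ::= true | c < k | c = k | c > k | φ ∧ φ`, with `k ∈ ℤ`. -/
inductive Guard (n : ℕ) : Type
  | tt : Guard n
  | lt (c : Fin n) (k : ℤ) : Guard n
  | eq (c : Fin n) (k : ℤ) : Guard n
  | gt (c : Fin n) (k : ℤ) : Guard n
  | and (φ ψ : Guard n) : Guard n

/-- A counter valuation satisfies a guard. -/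
def Guard.Sat {n : ℕ} (v : Fin n → ℕ) : Guard n → Prop
  | .tt => True
  | .lt c k => (v c : ℤ) < k
  | .eq c k => (v c : ℤ) = k
  | .gt c k => (v c : ℤ) > k
  | .and φ ψ => φ.Sat v ∧ ψ.Sat v

/-- The length of a guard; constants are written in binary. -/
def Guard.size {n : ℕ} : Guard n → ℕ
  | .tt => 1
  | .lt _ k => 2 + PresburgerZ.intBits k
  | .eq _ k => 2 + PresburgerZ.intBits k
  | .gt _ k => 2 + PresburgerZ.intBits k
  | .and φ ψ => 1 + φ.size + ψ.size

/-- Counter operations. -/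
inductive Op (n : ℕ) : Type
  | reset (c : Fin n) : Op n
  | inc (c : Fin n) : Op n
  | nop : Op n

/-- The relation between the counter valuations before and after an operation. -/
def Op.Rel {n : ℕ} : Op n → (Fin n → ℕ) → (Fin n → ℕ) → Prop
  | .nop, v, v' => v = v'
  | .reset i, v, v' => v' i = 0 ∧ ∀ j, j ≠ i → v' j = v j
  | .inc i, v, v' => v' i = v i + 1 ∧ ∀ j, j ≠ i → v' j = v j

/-- An edge `⟨s, φ, op, s'⟩`. -/
structure Edge (n : ℕ) (S : Type*) where
  source : S
  guard : Guard n
  op : Op n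
  target : S

/-- A monotonic counter machine with counters `c_0, …, c_{n-1}` and set of states `S`
is given by its finite set of edges. -/
structure Machine (n : ℕ) (S : Type*) where
  edges : Finset (Edge n S)

variable {n : ℕ} {S : Type*}

/-- The transition relation on configurations. -/
def Machine.Step (M : Machine n S) (p q : S × (Fin n → ℕ)) : Prop :=
  ∃ e ∈ M.edges, e.source = p.1 ∧ e.target = q.1 ∧ e.guard.Sat p.2 ∧ e.op.Rel p.2 q.2

/-- The reachability relation: the reflexive transitive closure of the transition relation. -/
def Machine.Reach (M : Machine n S) : S × (Fin n → ℕ) → S × (Fin n → ℕ) → Prop :=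
  Relation.ReflTransGen M.Step

/-- The set of pairs `⟨v, v'⟩ ∈ ℕ^{2n}` such that `⟨s', v'⟩` is reachable from `⟨s, v⟩`. -/
def Machine.reachSet (M : Machine n S) (s s' : S) : Set (Fin (n + n) → ℕ) :=
  {w | ∃ v v' : Fin n → ℕ, w = Fin.append v v' ∧ M.Reach (s, v) (s', v')}

/-- The size of a machine: each counter and each state counts one, and each edge counts one for
each of its two states and for its operation, in addition to the length of its guard (with
constants in binary). -/
def Machine.size [Fintype S] (M : Machine n S) : ℕ :=
  n + Fintype.card S + ∑ e ∈ M.edges, (3 + e.guard.size)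

end MonotonicCM

/-!
A counter changes only when it is reset or incremented, and the guards cannot distinguish values
beyond `B = 2 ^ |C|`. Abstract a configuration to its state, its counter values truncated at `B`,
and a guess of the set of *live* counters, those that will not be reset any more. The runs of the
machine are the walks of the resulting finite multigraph of exponential size. The final value of a
counter is its initial value, if it is live at the beginning, plus the number of its increments
while it is live; so it depends only on how often the walk uses each edge.

By Euler's theorem, given multiplicities are those of a walk from `a` to `b` iff they form a flow of
value one from `a` to `b` whose support is reachable from `a` within itself. The flow equations are
linear, and reachability is witnessed by ranks of the vertices: every vertex other than `a` that an
edge of the support leaves is entered by one from a vertex of smaller rank. This is an existential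
Presburger formula with one variable for each edge (its multiplicity) and one for each vertex (its
rank).
-/

/-! ### Walks and flows in directed multigraphs -/

/-- A directed multigraph with vertices `V` and edges `E`; loops and parallel edges are allowed. -/
structure Multidigraph (V E : Type*) where
  source : E → V
  target : E → V

namespace Multidigraph

variable {V E : Type*} (G : Multidigraph V E)

/-- The list of edges `l` is a walk from `a` to `b`. -/
def IsWalk (a : V) : List E → V → Prop
  | [], b => a = b
  | e :: l, b => G.source e = a ∧ IsWalk (G.target e) l b

/-- The walk `l` from `a` to `b` visits the vertex `v`, possibly as one of its end points. -/
def Visits (a : V) (l : List E) (b v : V) : Prop :=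
  ∃ l₁ l₂, l = l₁ ++ l₂ ∧ G.IsWalk a l₁ v ∧ G.IsWalk v l₂ b

/-- Adjacency through an edge in the support of `f`. -/
def SupportAdj (f : E → ℕ) (v w : V) : Prop :=
  ∃ e, 0 < f e ∧ G.source e = v ∧ G.target e = w

section Walk

variable {G} {a b : V} {l l₁ l₂ : List E}

theorem isWalk_append :
    G.IsWalk a (l₁ ++ l₂) b ↔ ∃ v, G.IsWalk a l₁ v ∧ G.IsWalk v l₂ b := by
  induction l₁ generalizing a with
  | nil => simp [IsWalk]
  | cons e l ih => simp [IsWalk, ih, and_assoc]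

theorem IsWalk.visits_start (h : G.IsWalk a l b) : G.Visits a l b a :=
  ⟨[], l, rfl, rfl, h⟩

theorem IsWalk.visits_target (h : G.IsWalk a l b) {e : E} (he : e ∈ l) :
    G.Visits a l b (G.target e) := by
  obtain ⟨l₁, l₂, rfl⟩ := List.append_of_mem he
  obtain ⟨v, h₁, hv, h₂⟩ := isWalk_append.1 h
  exact ⟨l₁ ++ [e], l₂, by simp, isWalk_append.2 ⟨v, h₁, hv, rfl⟩, h₂⟩

theorem IsWalk.reflTransGen_supportAdj {f : E → ℕ} (h : G.IsWalk a l b) (hf : ∀ e ∈ l, 0 < f e) :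
    ∀ e ∈ l, Relation.ReflTransGen (G.SupportAdj f) a (G.source e) := by
  induction l generalizing a with
  | nil => simp
  | cons d l ih =>
    obtain ⟨rfl, h⟩ := h
    rw [List.forall_mem_cons] at hf ⊢
    exact ⟨.refl, fun e he => .head ⟨d, hf.1, rfl, rfl⟩ (ih h hf.2 e he)⟩

end Walk

section Parikh

variable [DecidableEq E]

/-- The Parikh image of a list: the multiplicities of its entries. -/
def parikh (l : List E) : E → ℕ := fun e => l.count e

@[simp]
theorem parikh_nil : parikh ([] : List E) = 0 := rfl

theorem parikh_append (l₁ l₂ : List E) : parikh (l₁ ++ l₂) = parikh l₁ + parikh l₂ :=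
  funext fun _ => List.count_append

theorem parikh_cons (e : E) (l : List E) : parikh (e :: l) = Pi.single e 1 + parikh l := by
  funext d
  rcases eq_or_ne d e with rfl | h
  · simp [parikh, add_comm]
  · simp [parikh, h, h.symm]

theorem parikh_pos {e : E} {l : List E} : 0 < parikh l e ↔ e ∈ l :=
  List.count_pos_iff

theorem sum_filter_parikh [Fintype E] (p : E → Bool) (l : List E) :
    ∑ e with p e, parikh l e = l.countP p := by
  have hcount := Finset.sum_filter_count_eq_countP (p · = true) l
  simp only [Bool.decide_eq_true] at hcount
  rw [← hcount]
  refine (Finset.sum_subset (Finset.filter_subset_filter _ (Finset.subset_univ _)) ?_).symm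
  intro e he hel
  simp_all [parikh, List.count_eq_zero_of_not_mem]

theorem exists_eq_single_add {f : E → ℕ} {e : E} (he : 0 < f e) :
    ∃ g : E → ℕ, f = Pi.single e 1 + g := by
  refine exists_add_of_le fun d => ?_
  rcases eq_or_ne d e with rfl | hd
  · simpa using Nat.succ_le_of_lt he
  · simp [hd]

end Parikh

section Flow

variable [Fintype E] [DecidableEq V] {R : Type*}

/-- The total weight of the edges leaving `v`. -/
def outflow [AddCommMonoid R] (f : E → R) (v : V) : R := ∑ e with G.source e = v, f e

/-- The total weight of the edges entering `v`. -/
def inflow [AddCommMonoid R] (f : E → R) (v : V) : R := ∑ e with G.target e = v, f e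

/-- `f` is a flow of value one from `a` to `b`. The equation is written without subtraction so that
it makes sense for weights in `ℕ`. -/
def IsFlow [AddCommMonoidWithOne R] (f : E → R) (a b : V) : Prop :=
  G.outflow f + Pi.single b 1 = G.inflow f + Pi.single a 1

theorem outflow_add [AddCommMonoid R] (f g : E → R) :
    G.outflow (f + g) = G.outflow f + G.outflow g :=
  funext fun _ => Finset.sum_add_distrib

theorem inflow_add [AddCommMonoid R] (f g : E → R) :
    G.inflow (f + g) = G.inflow f + G.inflow g :=
  funext fun _ => Finset.sum_add_distrib

theorem outflow_single [AddCommMonoid R] [DecidableEq E] (e : E) (r : R) :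
    G.outflow (Pi.single e r) = Pi.single (G.source e) r := by
  funext v
  simp [outflow, Pi.single_apply, eq_comm]

theorem inflow_single [AddCommMonoid R] [DecidableEq E] (e : E) (r : R) :
    G.inflow (Pi.single e r) = Pi.single (G.target e) r := by
  funext v
  simp [inflow, Pi.single_apply, eq_comm]

variable {G} {f g : E → ℕ} {a b c : V}

theorem exists_pos_of_outflow_pos {v : V} (h : 0 < G.outflow f v) :
    ∃ e, G.source e = v ∧ 0 < f e := by
  simpa [outflow, Finset.sum_pos_iff] using h

theorem IsFlow.add (hf : G.IsFlow f a b) (hg : G.IsFlow g b c) : G.IsFlow (f + g) a c := by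
  rw [IsFlow, outflow_add, inflow_add]
  funext v
  have hfv := congrFun hf v
  have hgv := congrFun hg v
  simp only [Pi.add_apply] at hfv hgv ⊢
  omega

theorem IsFlow.of_add_left (hfg : G.IsFlow (f + g) a c) (hf : G.IsFlow f a b) :
    G.IsFlow g b c := by
  rw [IsFlow, outflow_add, inflow_add] at hfg
  funext v
  have hfv := congrFun hf v
  have hfgv := congrFun hfg v
  simp only [Pi.add_apply] at hfv hfgv ⊢
  omega

theorem isFlow_self_iff : G.IsFlow f a a ↔ G.outflow f = G.inflow f :=
  add_left_inj _

theorem isFlow_natCast : G.IsFlow (fun e => (f e : ℤ)) a b ↔ G.IsFlow f a b := by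
  simp only [IsFlow, funext_iff, outflow, inflow, Pi.add_apply, Pi.single_apply]
  norm_cast

variable [DecidableEq E]

theorem isFlow_single (e : E) :
    G.IsFlow (Pi.single e 1 : E → ℕ) (G.source e) (G.target e) := by
  rw [IsFlow, outflow_single, inflow_single, add_comm]

theorem IsWalk.isFlow {l : List E} (h : G.IsWalk a l b) : G.IsFlow (parikh l) a b := by
  induction l generalizing a with
  | nil =>
    obtain rfl : a = b := h
    exact isFlow_self_iff.2 (by simp [outflow, inflow, funext_iff])
  | cons e l ih =>
    obtain ⟨rfl, h⟩ := h
    rw [parikh_cons]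
    exact (isFlow_single e).add (ih h)

theorem IsFlow.exists_isWalk_le (hf : G.IsFlow f a b) :
    ∃ l, G.IsWalk a l b ∧ parikh l ≤ f := by
  induction f using WellFoundedLT.induction generalizing a with
  | ind f ih =>
    by_cases hab : a = b
    · exact ⟨[], hab, zero_le⟩
    have hout : 0 < G.outflow f a := by
      have := congrFun hf a
      simp only [Pi.add_apply, Pi.single_apply, hab, if_true, if_false] at this
      omega
    obtain ⟨e, rfl, he⟩ := exists_pos_of_outflow_pos hout
    obtain ⟨g, rfl⟩ := exists_eq_single_add he
    obtain ⟨l, hl, hlg⟩ := ih g (lt_add_of_pos_left g (by simp)) (hf.of_add_left (isFlow_single e))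
    exact ⟨e :: l, ⟨rfl, hl⟩, by rw [parikh_cons]; gcongr⟩

theorem IsFlow.exists_isWalk_cons_le {e : E} (hf : G.IsFlow f (G.source e) b) (he : 0 < f e) :
    ∃ l, G.IsWalk (G.source e) (e :: l) b ∧ parikh (e :: l) ≤ f := by
  obtain ⟨g, rfl⟩ := exists_eq_single_add he
  obtain ⟨l, hl, hlg⟩ := (hf.of_add_left (isFlow_single e)).exists_isWalk_le
  exact ⟨l, ⟨rfl, hl⟩, by rw [parikh_cons]; gcongr⟩

/- The flow that remains after removing `l` is a circulation, so it contains a closed walk through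
`e`, which is spliced into `l` at `source e`. -/
theorem IsFlow.exists_isWalk_gt {l : List E} {e : E} (hf : G.IsFlow f a b) (hl : parikh l ≤ f)
    (hv : G.Visits a l b (G.source e)) (he : parikh l e < f e) :
    ∃ l', G.IsWalk a l' b ∧ parikh l' ≤ f ∧ parikh l < parikh l' := by
  obtain ⟨l₁, l₂, rfl, h₁, h₂⟩ := hv
  obtain ⟨g, rfl⟩ := exists_add_of_le hl
  have hcirc : G.IsFlow g b b := hf.of_add_left (isWalk_append.2 ⟨_, h₁, h₂⟩).isFlow
  have hclosed : G.IsFlow g (G.source e) (G.source e) := isFlow_self_iff.2 (isFlow_self_iff.1 hcirc)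
  obtain ⟨m, hm, hmg⟩ := hclosed.exists_isWalk_cons_le (by simpa using he)
  have hparikh : parikh (l₁ ++ ((e :: m) ++ l₂)) = parikh (l₁ ++ l₂) + parikh (e :: m) := by
    simp only [parikh_append]
    abel
  refine ⟨_, isWalk_append.2 ⟨_, h₁, isWalk_append.2 ⟨_, hm, h₂⟩⟩, ?_, ?_⟩
  · rw [hparikh]
    gcongr
  · rw [hparikh, parikh_cons]
    exact lt_add_of_pos_right _ (add_pos_of_pos_of_nonneg (by simp) zero_le)

/-- **Euler's theorem**: a walk with maximal Parikh image below `f` uses up `f` at every vertex that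
it visits, since it could be extended otherwise, and therefore it visits the support of `f`. -/
theorem IsFlow.exists_isWalk_parikh_eq (hf : G.IsFlow f a b)
    (hconn : ∀ e, 0 < f e → Relation.ReflTransGen (G.SupportAdj f) a (G.source e)) :
    ∃ l, G.IsWalk a l b ∧ parikh l = f := by
  obtain ⟨l, ⟨hl, hle⟩, hmax⟩ := Set.Finite.exists_maximalFor' parikh
    {l | G.IsWalk a l b ∧ parikh l ≤ f}
    ((Set.finite_Iic f).subset (Set.image_subset_iff.2 fun _ => And.right)) hf.exists_isWalk_le
  have hsaturated : ∀ e, G.Visits a l b (G.source e) → parikh l e = f e := by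
    intro e he
    by_contra hne
    obtain ⟨l', hl', hle', hlt⟩ := hf.exists_isWalk_gt hle he (lt_of_le_of_ne (hle e) hne)
    exact hlt.not_ge (hmax ⟨hl', hle'⟩ hlt.le)
  have hvisits : ∀ v, Relation.ReflTransGen (G.SupportAdj f) a v → G.Visits a l b v := by
    intro v hv
    induction hv with
    | refl => exact hl.visits_start
    | tail _ hvw ih =>
      obtain ⟨e, he, rfl, rfl⟩ := hvw
      exact hl.visits_target (parikh_pos.1 (hsaturated e ih ▸ he))
  refine ⟨l, hl, funext fun e => ?_⟩
  rcases Nat.eq_zero_or_pos (f e) with he | he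
  · exact (hle e).antisymm (he ▸ Nat.zero_le _)
  · exact hsaturated e (hvisits _ (hconn e he))

end Flow

section RankedFlow

/-- The rank of `v` is the least number of steps from `a` to `v`. -/
theorem exists_rank {α : Type*} (r : α → α → Prop) (a : α) :
    ∃ z : α → ℕ, ∀ v, Relation.ReflTransGen r a v → v = a ∨ ∃ u, r u v ∧ z u < z v := by
  let steps : ℕ → α → Prop := Nat.rec (· = a) fun _ p v => ∃ u, r u v ∧ p u
  have hsteps : ∀ v, Relation.ReflTransGen r a v → ∃ k, steps k v := by
    intro v hv
    induction hv with
    | refl => exact ⟨0, rfl⟩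
    | tail _ huv ih =>
      obtain ⟨k, hk⟩ := ih
      exact ⟨k + 1, _, huv, hk⟩
  refine ⟨fun v => sInf {k | steps k v}, fun v hv => ?_⟩
  have hmin : steps (sInf {k | steps k v}) v := Nat.sInf_mem (s := {k | steps k v}) (hsteps v hv)
  generalize hk : sInf {k | steps k v} = k at hmin
  match k, hmin with
  | 0, hmin => exact .inl hmin
  | k + 1, ⟨u, huv, hku⟩ =>
    exact .inr ⟨u, huv, by simpa [hk, Nat.lt_succ_iff] using Nat.sInf_le hku⟩

variable [Fintype E] [DecidableEq V]

/-- A flow `f` of value one from `a` to `b` with nonnegative weights and connected support. The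
connectedness, which is not a linear condition on `f`, is witnessed by the rank `z`: an edge of the
support that does not leave `a` leaves a vertex that is entered from a vertex of smaller rank. -/
structure IsRankedFlow (f : E → ℤ) (z : V → ℤ) (a b : V) : Prop where
  nonneg : ∀ e, 0 ≤ f e
  isFlow : G.IsFlow f a b
  exists_pred : ∀ e, 0 < f e → G.source e = a ∨
    ∃ d, G.target d = G.source e ∧ 0 < f d ∧ z (G.source d) < z (G.source e)

variable {G} {a b : V}

theorem IsRankedFlow.reflTransGen {f : E → ℕ} {z : V → ℤ}
    (h : G.IsRankedFlow (fun e => (f e : ℤ)) z a b) {e : E} (he : 0 < f e) :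
    Relation.ReflTransGen (G.SupportAdj f) a (G.source e) := by
  let _ : Preorder E := .lift fun e => z (G.source e)
  induction e using WellFoundedLT.induction with
  | ind e ih =>
    rcases h.exists_pred e (by exact_mod_cast he) with hea | ⟨d, hd, hfd, hlt⟩
    · rw [hea]
    · have hfd : 0 < f d := by exact_mod_cast hfd
      exact .tail (ih d hlt hfd) ⟨d, hfd, rfl, hd⟩

variable [DecidableEq E]

theorem IsWalk.exists_isRankedFlow {l : List E} (hl : G.IsWalk a l b) :
    ∃ z, G.IsRankedFlow (fun e => (parikh l e : ℤ)) z a b := by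
  obtain ⟨z, hz⟩ := exists_rank (G.SupportAdj (parikh l)) a
  refine ⟨fun v => z v, fun e => by positivity, isFlow_natCast.2 hl.isFlow, fun e he => ?_⟩
  have hreach := hl.reflTransGen_supportAdj (fun _ => parikh_pos.2) e
    (parikh_pos.1 (by exact_mod_cast he))
  refine (hz _ hreach).imp_right ?_
  rintro ⟨_, ⟨d, hd, rfl, hde⟩, hlt⟩
  exact ⟨d, hde, by exact_mod_cast hd, by exact_mod_cast hlt⟩

theorem exists_isRankedFlow_iff {f : E → ℤ} :
    (∃ z, G.IsRankedFlow f z a b) ↔ ∃ l, G.IsWalk a l b ∧ f = fun e => (parikh l e : ℤ) := by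
  constructor
  · rintro ⟨z, h⟩
    lift f to E → ℕ using h.nonneg
    obtain ⟨l, hl, rfl⟩ :=
      (isFlow_natCast.1 h.isFlow).exists_isWalk_parikh_eq fun e he => h.reflTransGen he
    exact ⟨l, hl, rfl⟩
  · rintro ⟨l, hl, rfl⟩
    exact hl.exists_isRankedFlow

end RankedFlow

end Multidigraph

/-! ### Relations definable by small quantifier-free formulas -/

namespace PresburgerZ

variable {k i j m : ℕ} {f g h : (Fin k → ℤ) → ℤ} {P Q : (Fin k → ℤ) → Prop}

/-- The function `f` is the value of a term of length at most `2 ^ j`. -/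
def TermDefinable (j : ℕ) (f : (Fin k → ℤ) → ℤ) : Prop :=
  ∃ t : Term k, t.size ≤ 2 ^ j ∧ ∀ x, t.eval x = f x

/-- The relation `P` is defined by a quantifier-free formula of length at most `2 ^ j`. -/
def QFDefinable (j : ℕ) (P : (Fin k → ℤ) → Prop) : Prop :=
  ∃ φ : Formula k, φ.IsQF ∧ φ.size ≤ 2 ^ j ∧ ∀ x, φ.Holds x ↔ P x

theorem one_add_two_pow_add_two_pow_le (i j : ℕ) : 1 + 2 ^ i + 2 ^ j ≤ 2 ^ (max i j + 2) := by
  have hi : 2 ^ i ≤ 2 ^ max i j := Nat.pow_le_pow_right two_pos (le_max_left i j)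
  have hj : 2 ^ j ≤ 2 ^ max i j := Nat.pow_le_pow_right two_pos (le_max_right i j)
  have h1 : 1 ≤ 2 ^ max i j := Nat.one_le_two_pow
  rw [pow_add]
  omega

theorem four_add_mul_one_add_two_pow_le {c : ℕ} (hc : c ≤ 2 ^ m) (j : ℕ) :
    4 + c * (1 + 2 ^ j) ≤ 2 ^ (j + m + 3) := by
  have hj : 1 ≤ 2 ^ j := Nat.one_le_two_pow
  have hm : 1 ≤ 2 ^ m := Nat.one_le_two_pow
  calc 4 + c * (1 + 2 ^ j) ≤ 4 * (2 ^ m * 2 ^ j) + 2 ^ m * (2 ^ j + 2 ^ j) := by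
        gcongr
        nlinarith
    _ ≤ 2 ^ (j + m + 3) := by
        rw [pow_add, pow_add]
        nlinarith

theorem natSize_le_self (a : ℕ) : Nat.size a ≤ a := Nat.size_le.2 Nat.lt_two_pow_self

namespace TermDefinable

theorem const {c : ℤ} (hc : c.natAbs < 2 ^ j) : TermDefinable j fun _ : Fin k → ℤ => c := by
  refine ⟨.const c, ?_, fun _ => rfl⟩
  calc 1 + Nat.size c.natAbs ≤ 1 + j := by gcongr; exact Nat.size_le.2 hc
    _ ≤ 2 ^ j := by rw [add_comm]; exact Nat.lt_two_pow_self

theorem var (hk : k ≤ 2 ^ m) (i : Fin k) : TermDefinable m fun x : Fin k → ℤ => x i := by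
  refine ⟨.var i, ?_, fun _ => rfl⟩
  calc 1 + Nat.size i ≤ 1 + i := by gcongr; exact natSize_le_self i
    _ ≤ 2 ^ m := by omega

theorem ite (p : Prop) [Decidable p] (hf : TermDefinable j f) :
    TermDefinable j fun x => if p then f x else 0 := by
  split_ifs
  · exact hf
  · exact const (by simp)

theorem add (hf : TermDefinable i f) (hg : TermDefinable j g) :
    TermDefinable (max i j + 2) fun x => f x + g x := by
  obtain ⟨t, ht, htf⟩ := hf
  obtain ⟨u, hu, hug⟩ := hg
  refine ⟨.add t u, ?_, fun x => by rw [Term.eval, htf, hug]⟩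
  calc 1 + t.size + u.size ≤ 1 + 2 ^ i + 2 ^ j := by gcongr
    _ ≤ _ := one_add_two_pow_add_two_pow_le i j

theorem sum {ι : Type*} {s : Finset ι} (hs : s.card ≤ 2 ^ m) {f : ι → (Fin k → ℤ) → ℤ}
    (hf : ∀ i, TermDefinable j (f i)) :
    TermDefinable (j + m + 3) fun x => ∑ i ∈ s, f i x := by
  classical
  suffices ∃ t : Term k, t.size ≤ 4 + s.card * (1 + 2 ^ j) ∧ ∀ x, t.eval x = ∑ i ∈ s, f i x by
    obtain ⟨t, ht, htf⟩ := this
    exact ⟨t, ht.trans (four_add_mul_one_add_two_pow_le hs j), htf⟩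
  clear hs
  induction s using Finset.induction with
  | empty => exact ⟨.const 0, by simp [Term.size, intBits], fun x => rfl⟩
  | insert a s ha ih =>
    obtain ⟨t, ht, htf⟩ := ih
    obtain ⟨u, hu, huf⟩ := hf a
    refine ⟨.add u t, ?_, fun x => by rw [Term.eval, huf, htf, Finset.sum_insert ha]⟩
    rw [Term.size, Finset.card_insert_of_notMem ha, add_mul, one_mul]
    omega

end TermDefinable

namespace QFDefinable

theorem mono (hP : QFDefinable i P) (h : i ≤ j) : QFDefinable j P := by
  obtain ⟨φ, hφ, hsize, hholds⟩ := hP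
  exact ⟨φ, hφ, hsize.trans (Nat.pow_le_pow_right two_pos h), hholds⟩

theorem congr (hP : QFDefinable j P) (h : ∀ x, P x ↔ Q x) : QFDefinable j Q := by
  rwa [funext fun x => propext (h x)] at hP

theorem le (hf : TermDefinable i f) (hg : TermDefinable j g) :
    QFDefinable (max i j + 2) fun x => f x ≤ g x := by
  obtain ⟨t, ht, htf⟩ := hf
  obtain ⟨u, hu, hug⟩ := hg
  refine ⟨.le t u, .le t u, ?_, fun x => by rw [Formula.Holds, htf, hug]⟩
  calc 1 + t.size + u.size ≤ 1 + 2 ^ i + 2 ^ j := by gcongr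
    _ ≤ _ := one_add_two_pow_add_two_pow_le i j

theorem not (hP : QFDefinable j P) : QFDefinable (j + 1) fun x => ¬ P x := by
  obtain ⟨φ, hφ, hsize, hholds⟩ := hP
  refine ⟨.not φ, .not hφ, ?_, fun x => by rw [Formula.Holds, hholds]⟩
  calc 1 + φ.size ≤ 2 ^ j + 2 ^ j := by gcongr; exact Nat.one_le_two_pow
    _ = 2 ^ (j + 1) := by ring

theorem and (hP : QFDefinable i P) (hQ : QFDefinable j Q) :
    QFDefinable (max i j + 2) fun x => P x ∧ Q x := by
  obtain ⟨φ, hφ, hsizeφ, hholdsφ⟩ := hP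
  obtain ⟨ψ, hψ, hsizeψ, hholdsψ⟩ := hQ
  refine ⟨.and φ ψ, .and hφ hψ, ?_, fun x => by rw [Formula.Holds, hholdsφ, hholdsψ]⟩
  calc 1 + φ.size + ψ.size ≤ 1 + 2 ^ i + 2 ^ j := by gcongr
    _ ≤ _ := one_add_two_pow_add_two_pow_le i j

theorem or (hP : QFDefinable i P) (hQ : QFDefinable j Q) :
    QFDefinable (max i j + 2) fun x => P x ∨ Q x := by
  obtain ⟨φ, hφ, hsizeφ, hholdsφ⟩ := hP
  obtain ⟨ψ, hψ, hsizeψ, hholdsψ⟩ := hQ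
  refine ⟨.or φ ψ, .or hφ hψ, ?_, fun x => by rw [Formula.Holds, hholdsφ, hholdsψ]⟩
  calc 1 + φ.size + ψ.size ≤ 1 + 2 ^ i + 2 ^ j := by gcongr
    _ ≤ _ := one_add_two_pow_add_two_pow_le i j

theorem imp (hP : QFDefinable i P) (hQ : QFDefinable j Q) :
    QFDefinable (max (i + 1) j + 2) fun x => P x → Q x :=
  (hP.not.or hQ).congr fun _ => imp_iff_not_or.symm

theorem lt (hf : TermDefinable i f) (hg : TermDefinable j g) :
    QFDefinable (max i j + 3) fun x => f x < g x :=
  max_comm i j ▸ (le hg hf).not.congr fun _ => not_le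

theorem eq (hf : TermDefinable i f) (hg : TermDefinable j g) :
    QFDefinable (max i j + 4) fun x => f x = g x :=
  (((le hf hg).and (le hg hf)).congr fun _ => le_antisymm_iff.symm).mono (by omega)

theorem min_eq {l : ℕ} (hf : TermDefinable i f) (hg : TermDefinable j g)
    (hh : TermDefinable l h) :
    QFDefinable (max (max i j) l + 8) fun x => min (f x) (g x) = h x :=
  ((((eq hf hh).and (le hf hg)).or ((eq hg hh).and (le hg hf))).congr
    fun _ => min_eq_iff.symm).mono (by omega)

theorem prop (p : Prop) : QFDefinable 2 fun _ : Fin k → ℤ => p := by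
  by_cases hp : p
  · exact ⟨.le (.const 0) (.const 0), .le _ _, by simp [Formula.size, Term.size, intBits],
      fun x => by simp [Formula.Holds, hp]⟩
  · exact ⟨.le (.const 1) (.const 0), .le _ _, by simp [Formula.size, Term.size, intBits],
      fun x => by simp [Formula.Holds, Term.eval, hp]⟩

theorem exists_mem {ι : Type*} {s : Finset ι} (hs : s.card ≤ 2 ^ m) {P : ι → (Fin k → ℤ) → Prop}
    (hP : ∀ i, QFDefinable j (P i)) : QFDefinable (j + m + 3) fun x => ∃ i ∈ s, P i x := by
  classical
  suffices ∃ φ : Formula k, φ.IsQF ∧ φ.size ≤ 4 + s.card * (1 + 2 ^ j) ∧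
      ∀ x, φ.Holds x ↔ ∃ i ∈ s, P i x by
    obtain ⟨φ, hφ, hsize, hholds⟩ := this
    exact ⟨φ, hφ, hsize.trans (four_add_mul_one_add_two_pow_le hs j), hholds⟩
  clear hs
  induction s using Finset.induction with
  | empty => simpa [QFDefinable] using prop (k := k) False
  | insert a s ha ih =>
    obtain ⟨φ, hφ, hsizeφ, hholdsφ⟩ := ih
    obtain ⟨ψ, hψ, hsizeψ, hholdsψ⟩ := hP a
    refine ⟨.or ψ φ, .or hψ hφ, ?_, fun x => ?_⟩
    · rw [Formula.size, Finset.card_insert_of_notMem ha, add_mul, one_mul]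
      omega
    · rw [Formula.Holds, hholdsφ, hholdsψ, Finset.exists_mem_insert]

variable {ι : Type*} [Fintype ι] {P : ι → (Fin k → ℤ) → Prop}

theorem ex (hι : Fintype.card ι ≤ 2 ^ m) (hP : ∀ i, QFDefinable j (P i)) :
    QFDefinable (j + m + 3) fun x => ∃ i, P i x :=
  (exists_mem (s := Finset.univ) hι hP).congr fun _ => by simp

theorem all (hι : Fintype.card ι ≤ 2 ^ m) (hP : ∀ i, QFDefinable j (P i)) :
    QFDefinable (j + m + 5) fun x => ∀ i, P i x :=
  (((ex hι fun i => (hP i).not).not).congr fun _ => not_exists_not).mono (by omega)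

variable {V E : Type*} [Fintype V] [Fintype E] [DecidableEq V] (G : Multidigraph V E)
  {y : E → (Fin k → ℤ) → ℤ} {z : V → (Fin k → ℤ) → ℤ}

theorem isFlow (hV : Fintype.card V ≤ 2 ^ m) (hE : Fintype.card E ≤ 2 ^ m)
    (hy : ∀ e, TermDefinable j (y e)) (a b : V) :
    QFDefinable (j + 2 * m + 14) fun x => G.IsFlow (fun e => y e x) a b := by
  have hsum (p : E → Prop) [DecidablePred p] :
      TermDefinable (j + m + 3) fun x => ∑ e with p e, y e x :=
    .sum ((Finset.card_le_univ _).trans hE) hy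
  have hsingle (u v : V) :
      TermDefinable 1 fun _ : Fin k → ℤ => (Pi.single u 1 : V → ℤ) v :=
    .const (by rw [Pi.single_apply]; split_ifs <;> decide)
  exact ((all hV fun v => eq ((hsum (G.source · = v)).add (hsingle b v))
    ((hsum (G.target · = v)).add (hsingle a v))).congr fun x => funext_iff.symm).mono (by omega)

theorem isRankedFlow (hV : Fintype.card V ≤ 2 ^ m) (hE : Fintype.card E ≤ 2 ^ m)
    (hy : ∀ e, TermDefinable j (y e)) (hz : ∀ v, TermDefinable j (z v)) (a b : V) :
    QFDefinable (j + 2 * m + 30) fun x =>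
      G.IsRankedFlow (fun e => y e x) (fun v => z v x) a b := by
  have hzero : TermDefinable 0 fun _ : Fin k → ℤ => 0 := .const (by simp)
  have hnonneg : QFDefinable _ fun x => ∀ e, 0 ≤ y e x := all hE fun e => le hzero (hy e)
  have hpred : QFDefinable _ fun x => ∀ e, 0 < y e x → G.source e = a ∨
      ∃ d, G.target d = G.source e ∧ 0 < y d x ∧ z (G.source d) x < z (G.source e) x :=
    all hE fun e => (lt hzero (hy e)).imp <| (prop _).or <| ex hE fun d =>
      (prop _).and <| (lt hzero (hy d)).and (lt (hz _) (hz _))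
  exact ((hnonneg.and ((isFlow G hV hE hy a b).and hpred)).congr fun x =>
    ⟨fun ⟨h₁, h₂, h₃⟩ => ⟨h₁, h₂, h₃⟩, fun ⟨h₁, h₂, h₃⟩ => ⟨h₁, h₂, h₃⟩⟩).mono (by omega)

end QFDefinable

/-! ### Blocks of existential quantifiers -/

theorem Formula.IsExistential.exists_block (m : ℕ) (φ : Formula (k + m)) (hφ : φ.IsExistential) :
    ∃ ψ : Formula k, ψ.IsExistential ∧ ψ.size ≤ m * (2 + (k + m)) + φ.size ∧
      ∀ x, ψ.Holds x ↔ ∃ y : Fin m → ℤ, φ.Holds (Fin.append x y) := by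
  induction m with
  | zero =>
    refine ⟨φ, hφ, by omega, fun x => ?_⟩
    rw [Fin.exists_fin_zero_pi, Fin.append_right_nil _ _ rfl]
    rfl
  | succ m ih =>
    obtain ⟨ψ, hψ, hsize, hholds⟩ := ih (.ex φ) (.ex hφ)
    refine ⟨ψ, hψ, ?_, fun x => ?_⟩
    · have := natSize_le_self (k + m)
      rw [Formula.size] at hsize
      nlinarith
    · simp only [hholds, Formula.Holds, ← Fin.append_snoc]
      exact ⟨fun ⟨y, a, h⟩ => ⟨Fin.snoc y a, h⟩,
        fun ⟨y, h⟩ => ⟨Fin.init y, y (Fin.last m), by rwa [Fin.snoc_init_self]⟩⟩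

theorem QFDefinable.exists_isExistential {W : Type*} [Fintype W] (hk : k + Fintype.card W ≤ 2 ^ m)
    {P : (Fin k → ℤ) → (W → ℤ) → Prop}
    (hP : QFDefinable j fun x : Fin (k + Fintype.card W) → ℤ =>
      P (fun i => x (Fin.castAdd _ i)) (fun w => x (Fin.natAdd k (Fintype.equivFin W w)))) :
    ∃ φ : Formula k, φ.IsExistential ∧ φ.size ≤ 2 ^ (j + 2 * m + 2) ∧
      ∀ x, φ.Holds x ↔ ∃ y : W → ℤ, P x y := by
  obtain ⟨φ, hφ, hsize, hholds⟩ := hP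
  obtain ⟨ψ, hψ, hsizeψ, hholdsψ⟩ := Formula.IsExistential.exists_block _ φ (.of_isQF hφ)
  refine ⟨ψ, hψ, ?_, fun x => ?_⟩
  · have hm : 1 ≤ 2 ^ m := Nat.one_le_two_pow
    have hj : 1 ≤ 2 ^ j := Nat.one_le_two_pow
    calc ψ.size ≤ 2 ^ m * (2 + 2 ^ m) + 2 ^ j := hsizeψ.trans (by gcongr; omega)
      _ ≤ 3 * (2 ^ m) ^ 2 + 2 ^ j := by nlinarith
      _ ≤ 4 * (2 ^ j * (2 ^ m) ^ 2) := by nlinarith [Nat.one_le_pow 2 _ hm]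
      _ = 2 ^ (j + 2 * m + 2) := by ring
  · simp only [hholdsψ, hholds, Fin.append_left, Fin.append_right]
    exact ((Fintype.equivFin W).arrowCongr (Equiv.refl ℤ)).exists_congr_left.symm

end PresburgerZ

/-! ### The abstraction of a monotonic counter machine -/

namespace MonotonicCM

open PresburgerZ

variable {n : ℕ} {S : Type*} {B : ℕ}

/-- Counter values truncated at `B`. -/
def truncate (B : ℕ) (v : Fin n → ℕ) : Fin n → Fin (B + 1) :=
  fun c => ⟨min (v c) B, by omega⟩

theorem truncate_eq_iff {v : Fin n → ℕ} {t : Fin n → Fin (B + 1)} :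
    truncate B v = t ↔ ∀ c, min (v c) B = t c := by
  simp [funext_iff, truncate, Fin.ext_iff]

theorem natAbs_lt_of_two_pow_le {k : ℤ} (h : 2 ^ (2 + intBits k) ≤ B) : k.natAbs < B :=
  (Nat.size_le.1 (by rw [intBits]; omega)).trans_le h

theorem Guard.sat_truncate_iff (φ : Guard n) (hφ : 2 ^ φ.size ≤ B) (v : Fin n → ℕ) :
    φ.Sat (fun c => truncate B v c) ↔ φ.Sat v := by
  induction φ with
  | tt => rfl
  | lt c k | eq c k | gt c k =>
    have := natAbs_lt_of_two_pow_le hφ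
    simp only [Guard.Sat, truncate]
    omega
  | and φ ψ ihφ ihψ =>
    rw [Guard.size] at hφ
    exact and_congr (ihφ ((Nat.pow_le_pow_right two_pos (by omega)).trans hφ))
      (ihψ ((Nat.pow_le_pow_right two_pos (by omega)).trans hφ))

/-- The counter valuation after an operation. -/
def Op.apply : Op n → (Fin n → ℕ) → Fin n → ℕ
  | .reset c, v => Function.update v c 0
  | .inc c, v => Function.update v c (v c + 1)
  | .nop, v => v

theorem Op.rel_iff {op : Op n} {v v' : Fin n → ℕ} : op.Rel v v' ↔ v' = op.apply v := by
  cases op with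
  | reset c | inc c => exact Function.eq_update_iff.symm
  | nop => exact eq_comm

theorem Op.truncate_apply_truncate (op : Op n) (v : Fin n → ℕ) :
    truncate B (op.apply fun c => truncate B v c) = truncate B (op.apply v) := by
  rw [truncate_eq_iff]
  intro c
  cases op with
  | reset i | inc i =>
    simp only [Op.apply, truncate, Function.update_apply]
    split_ifs <;> omega
  | nop => simp [Op.apply, truncate]

/-- A counter is live at some point of a run if it is not reset from there on. This is the set of
live counters before an operation, given the set `D` of live counters after it. -/
def Op.liveBefore : Op n → Finset (Fin n) → Finset (Fin n)
  | .reset c, D => D.erase c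
  | _, D => D

/-- The operation increments the counter `c`, which is live if `D` is the set of live counters. -/
def Op.incrementsLive : Op n → Finset (Fin n) → Fin n → Bool
  | .inc i, D, c => decide (c = i ∧ c ∈ D)
  | _, _, _ => false

theorem Op.apply_eq_of_live (op : Op n) (v : Fin n → ℕ) (D : Finset (Fin n)) (c : Fin n) :
    (if c ∈ D then op.apply v c else 0) =
      (if c ∈ op.liveBefore D then v c else 0) + if op.incrementsLive D c then 1 else 0 := by
  cases op with
  | reset i | inc i =>
    by_cases hD : c ∈ D <;> rcases eq_or_ne c i with rfl | hne <;>
      simp_all [Op.apply, Op.liveBefore, Op.incrementsLive]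
  | nop => exact (add_zero _).symm

/-- States of the abstraction: a state of the machine, the truncated counter values, and the set of
live counters. -/
abbrev AbsState (n : ℕ) (S : Type*) (B : ℕ) : Type _ :=
  S × (Fin n → Fin (B + 1)) × Finset (Fin n)

/-- Edges of the abstraction: an edge of the machine, the truncated counter values before it, which
satisfy its guard, and the set of live counters after it. -/
structure AbsEdge (M : Machine n S) (B : ℕ) where
  edge : {e // e ∈ M.edges}
  start : Fin n → Fin (B + 1)
  live : Finset (Fin n)
  sat : edge.1.guard.Sat fun c => start c

variable {M : Machine n S}

/-- The edge increments the live counter `c`. -/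
def AbsEdge.incrementsLive (e : AbsEdge M B) (c : Fin n) : Bool :=
  e.edge.1.op.incrementsLive e.live c

variable (M B) in
/-- The abstraction of a machine: its configurations with counter values truncated at `B`, together
with a guess of the live counters that every edge checks. -/
def Machine.abstraction : Multidigraph (AbsState n S B) (AbsEdge M B) where
  source e := (e.edge.1.source, e.start, e.edge.1.op.liveBefore e.live)
  target e := (e.edge.1.target, truncate B (e.edge.1.op.apply fun c => e.start c), e.live)

theorem Machine.abstraction_target {d : AbsEdge M B} {v : Fin n → ℕ} (h : d.start = truncate B v) :
    (M.abstraction B).target d =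
      (d.edge.1.target, truncate B (d.edge.1.op.apply v), d.live) := by
  simp only [Machine.abstraction, h, Op.truncate_apply_truncate]

/-- The counter values after a run from the counter values `v` that follows the walk `l`, where `D`
is the set of live counters at its beginning. -/
def finalValue (v : Fin n → ℕ) (D : Finset (Fin n)) (l : List (AbsEdge M B)) (c : Fin n) : ℕ :=
  (if c ∈ D then v c else 0) + l.countP (·.incrementsLive c)

theorem finalValue_nil (v : Fin n → ℕ) :
    finalValue v Finset.univ ([] : List (AbsEdge M B)) = v := by
  simp [finalValue, funext_iff]

theorem finalValue_cons (v : Fin n → ℕ) (d : AbsEdge M B) (l : List (AbsEdge M B)) :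
    finalValue v (d.edge.1.op.liveBefore d.live) (d :: l) =
      finalValue (d.edge.1.op.apply v) d.live l := by
  funext c
  rw [finalValue, finalValue, Op.apply_eq_of_live, List.countP_cons, AbsEdge.incrementsLive]
  ring

theorem Machine.Reach.exists_isWalk (hB : ∀ e ∈ M.edges, 2 ^ e.guard.size ≤ B)
    {p q : S × (Fin n → ℕ)} (h : M.Reach p q) :
    ∃ D l, (M.abstraction B).IsWalk (p.1, truncate B p.2, D) l
        (q.1, truncate B q.2, Finset.univ) ∧ q.2 = finalValue p.2 D l := by
  induction h using Relation.ReflTransGen.head_induction_on with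
  | refl => exact ⟨Finset.univ, [], rfl, (finalValue_nil _).symm⟩
  | @head p p' hstep _ ih =>
    obtain ⟨D, l, hl, hq⟩ := ih
    obtain ⟨e, he, hp, hp', hsat, hop⟩ := hstep
    rw [← hp', Op.rel_iff.1 hop] at hl
    let d : AbsEdge M B :=
      ⟨⟨e, he⟩, truncate B p.2, D, (e.guard.sat_truncate_iff (hB e he) p.2).2 hsat⟩
    refine ⟨e.op.liveBefore D, d :: l, ⟨by rw [← hp]; rfl, ?_⟩, ?_⟩
    · rwa [Machine.abstraction_target rfl]
    · rw [hq, Op.rel_iff.1 hop]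
      exact (finalValue_cons p.2 d l).symm

theorem Machine.reach_of_isWalk (hB : ∀ e ∈ M.edges, 2 ^ e.guard.size ≤ B) {s s' : S}
    {v : Fin n → ℕ} {D : Finset (Fin n)} {r : Fin n → Fin (B + 1)} {l : List (AbsEdge M B)}
    (h : (M.abstraction B).IsWalk (s, truncate B v, D) l (s', r, Finset.univ)) :
    M.Reach (s, v) (s', finalValue v D l) := by
  induction l generalizing s v D with
  | nil =>
    obtain ⟨rfl, -, rfl⟩ : s = s' ∧ truncate B v = r ∧ D = Finset.univ := by
      simpa [Multidigraph.IsWalk] using h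
    rw [finalValue_nil]
    exact .refl
  | cons d l ih =>
    obtain ⟨hd, hl⟩ := h
    obtain ⟨rfl, hstart, rfl⟩ : d.edge.1.source = s ∧ d.start = truncate B v ∧
        d.edge.1.op.liveBefore d.live = D := by
      simpa [Machine.abstraction] using hd
    have hsat : d.edge.1.guard.Sat v :=
      (Guard.sat_truncate_iff _ (hB _ d.edge.2) v).1 (hstart ▸ d.sat)
    rw [Machine.abstraction_target hstart] at hl
    rw [finalValue_cons]
    exact .head ⟨d.edge.1, d.edge.2, rfl, rfl, hsat, Op.rel_iff.2 rfl⟩ (ih hl)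

theorem Machine.reach_iff_exists_isWalk (hB : ∀ e ∈ M.edges, 2 ^ e.guard.size ≤ B) {s s' : S}
    {v v' : Fin n → ℕ} :
    M.Reach (s, v) (s', v') ↔ ∃ D r l,
      (M.abstraction B).IsWalk (s, truncate B v, D) l (s', r, Finset.univ) ∧
        v' = finalValue v D l := by
  constructor
  · intro h
    obtain ⟨D, l, hl, hv'⟩ := h.exists_isWalk hB
    exact ⟨D, _, l, hl, hv'⟩
  · rintro ⟨D, r, l, hl, rfl⟩
    exact reach_of_isWalk hB hl

theorem Machine.mem_reachSet_iff {s s' : S} {w : Fin (n + n) → ℕ} :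
    w ∈ M.reachSet s s' ↔
      M.Reach (s, fun c => w (Fin.castAdd n c)) (s', fun c => w (Fin.natAdd n c)) := by
  constructor
  · rintro ⟨v, v', rfl, h⟩
    simpa only [Fin.append_left, Fin.append_right] using h
  · exact fun h => ⟨_, _, Fin.append_castAdd_natAdd.symm, h⟩

/-! ### Certificates of reachability -/

noncomputable instance : DecidableEq (AbsEdge M B) := Classical.decEq _

theorem AbsEdge.injective_toProd :
    Function.Injective fun e : AbsEdge M B => (e.edge, e.start, e.live) := by
  rintro ⟨e, t, D, _⟩ ⟨e', t', D', _⟩ h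
  simpa using h

noncomputable instance : Fintype (AbsEdge M B) :=
  .ofInjective _ AbsEdge.injective_toProd

section Certificates

variable [DecidableEq S]

/-- The numbers `y e` and `z q` certify that `x = (v, v')` belongs to the reachability relation from
`s` to `s'`: the `y e` are the multiplicities of the edges of a walk of the abstraction, as
witnessed by the ranks `z q`, along which the counter values change from `v` to `v'`. -/
def ReachCertificate (M : Machine n S) (B : ℕ) (s s' : S) (x : Fin (n + n) → ℤ)
    (y : AbsEdge M B → ℤ) (z : AbsState n S B → ℤ) : Prop :=
  (∀ i, 0 ≤ x i) ∧ ∃ t D r, (∀ c, min (x (Fin.castAdd n c)) B = t c) ∧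
    (M.abstraction B).IsRankedFlow y z (s, t, D) (s', r, Finset.univ) ∧
    ∀ c, x (Fin.natAdd n c) =
      (if c ∈ D then x (Fin.castAdd n c) else 0) + ∑ e with e.incrementsLive c, y e

theorem exists_reachCertificate_iff (hB : ∀ e ∈ M.edges, 2 ^ e.guard.size ≤ B) {s s' : S}
    {x : Fin (n + n) → ℤ} :
    (∃ y z, ReachCertificate M B s s' x y z) ↔ ∃ w ∈ M.reachSet s s', ∀ i, x i = w i := by
  simp only [Machine.mem_reachSet_iff, Machine.reach_iff_exists_isWalk hB]
  have hfinal (w : Fin (n + n) → ℕ) (D : Finset (Fin n)) (l : List (AbsEdge M B)) :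
      (fun c => w (Fin.natAdd n c)) = finalValue (fun c => w (Fin.castAdd n c)) D l ↔
        ∀ c, (w (Fin.natAdd n c) : ℤ) = (if c ∈ D then (w (Fin.castAdd n c) : ℤ) else 0) +
          ∑ e with e.incrementsLive c, (Multidigraph.parikh l e : ℤ) := by
    simp only [funext_iff, finalValue, ← Multidigraph.sum_filter_parikh]
    norm_cast
  constructor
  · rintro ⟨y, z, hx, t, D, r, ht, hflow, hc⟩
    lift x to Fin (n + n) → ℕ using hx
    obtain ⟨l, hl, rfl⟩ := Multidigraph.exists_isRankedFlow_iff.1 ⟨z, hflow⟩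
    have htrunc : truncate B (fun c => x (Fin.castAdd n c)) = t :=
      truncate_eq_iff.2 fun c => Nat.cast_injective (R := ℤ) (by simpa using ht c)
    exact ⟨x, ⟨D, r, l, htrunc ▸ hl, (hfinal x D l).2 hc⟩, fun i => rfl⟩
  · rintro ⟨w, ⟨D, r, l, hl, hw⟩, hx⟩
    obtain rfl := funext hx
    obtain ⟨z, hz⟩ := Multidigraph.exists_isRankedFlow_iff.2 ⟨l, hl, rfl⟩
    exact ⟨_, z, fun i => by positivity, _, D, r, fun c => by simp [truncate], hz,
      (hfinal w D l).1 hw⟩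

theorem qfDefinable_reachCertificate {k j m : ℕ} {x : Fin (n + n) → (Fin k → ℤ) → ℤ}
    {y : AbsEdge M B → (Fin k → ℤ) → ℤ} {z : AbsState n S B → (Fin k → ℤ) → ℤ}
    [Fintype S] (hn : n + n ≤ 2 ^ m) (hB : B < 2 ^ j) (hV : Fintype.card (AbsState n S B) ≤ 2 ^ m)
    (hE : Fintype.card (AbsEdge M B) ≤ 2 ^ m) (hx : ∀ i, TermDefinable j (x i))
    (hy : ∀ e, TermDefinable j (y e)) (hz : ∀ q, TermDefinable j (z q)) (s s' : S) :
    QFDefinable (j + 5 * m + 50) fun ξ =>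
      ReachCertificate M B s s' (fun i => x i ξ) (fun e => y e ξ) (fun q => z q ξ) := by
  have hcard {α : Type} [Fintype α] {g : α → AbsState n S B} (hg : Function.Injective g) :
      Fintype.card α ≤ 2 ^ m := (Fintype.card_le_of_injective g hg).trans hV
  have hcounters : Fintype.card (Fin n) ≤ 2 ^ m := by rw [Fintype.card_fin]; omega
  have hnonneg : QFDefinable (j + m + 7) fun ξ => ∀ i, 0 ≤ x i ξ :=
    (QFDefinable.all (by rwa [Fintype.card_fin]) fun i =>
      .le (.const (j := 0) (by simp)) (hx i)).mono (by omega)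
  have hstart (t : Fin n → Fin (B + 1)) : QFDefinable (j + m + 13) fun ξ =>
      ∀ c, min (x (Fin.castAdd n c) ξ) B = t c :=
    (QFDefinable.all hcounters fun c => .min_eq (hx _) (.const (j := j) (by simpa))
      (.const (j := j) (by simpa using (Fin.is_le (t c)).trans_lt hB))).mono (by omega)
  have hfinal (D : Finset (Fin n)) : QFDefinable (j + 2 * m + 14) fun ξ => ∀ c,
      x (Fin.natAdd n c) ξ = (if c ∈ D then x (Fin.castAdd n c) ξ else 0) +
        ∑ e with e.incrementsLive c, y e ξ :=
    (QFDefinable.all hcounters fun c => .eq (hx _) (.add (.ite _ (hx _))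
      (.sum ((Finset.card_le_univ _).trans hE) hy))).mono (by omega)
  refine (hnonneg.and (.ex (hcard (g := fun t => (s, t, ∅)) fun _ _ h => by simpa using h)
    fun t => .ex (hcard (g := fun D => (s, 0, D)) fun _ _ h => by simpa using h)
    fun D => .ex (hcard (g := fun r => (s, r, ∅)) fun _ _ h => by simpa using h)
    fun r => (hstart t).and ((QFDefinable.isRankedFlow _ hV hE hy hz _ _).and (hfinal D)))).mono
    (by omega)

end Certificates

/-! ### Size bounds -/

variable [Fintype S]

theorem Machine.card_edges_le_size (M : Machine n S) : M.edges.card ≤ M.size := by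
  have : M.edges.card • 1 ≤ ∑ e ∈ M.edges, (3 + e.guard.size) :=
    Finset.card_nsmul_le_sum _ _ _ fun e _ => by omega
  rw [smul_eq_mul] at this
  rw [Machine.size]
  omega

theorem Machine.guard_size_le_size {e : Edge n S} (he : e ∈ M.edges) :
    e.guard.size ≤ M.size := by
  have := Finset.single_le_sum (f := fun e : Edge n S => 3 + e.guard.size)
    (fun _ _ => Nat.zero_le _) he
  rw [Machine.size]
  omega

theorem mul_card_truncated_le {L a : ℕ} (ha : a ≤ L) (hn : n ≤ L) :
    a * ((2 ^ L + 1) ^ n * 2 ^ n) ≤ 2 ^ (L ^ 2 + 3 * L) := by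
  calc a * ((2 ^ L + 1) ^ n * 2 ^ n) ≤ 2 ^ L * ((2 ^ (L + 1)) ^ L * 2 ^ L) := by
        gcongr
        · exact ha.trans Nat.lt_two_pow_self.le
        · exact Nat.one_le_two_pow
        · rw [pow_succ, mul_two]
          gcongr
          exact Nat.one_le_two_pow
        · exact one_le_two
    _ = 2 ^ (L ^ 2 + 3 * L) := by ring

theorem card_absState_le (M : Machine n S) :
    Fintype.card (AbsState n S (2 ^ M.size)) ≤ 2 ^ (M.size ^ 2 + 3 * M.size) := by
  have hS : Fintype.card S ≤ M.size := by rw [Machine.size]; omega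
  have hn : n ≤ M.size := by rw [Machine.size]; omega
  simpa using mul_card_truncated_le hS hn

theorem card_absEdge_le (M : Machine n S) :
    Fintype.card (AbsEdge M (2 ^ M.size)) ≤ 2 ^ (M.size ^ 2 + 3 * M.size) := by
  have hn : n ≤ M.size := by rw [Machine.size]; omega
  calc Fintype.card (AbsEdge M (2 ^ M.size))
      ≤ M.edges.card * ((2 ^ M.size + 1) ^ n * 2 ^ n) := by
        simpa using Fintype.card_le_of_injective _
          (AbsEdge.injective_toProd (M := M) (B := 2 ^ M.size))
    _ ≤ _ := mul_card_truncated_le M.card_edges_le_size hn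

theorem card_variables_le (M : Machine n S) :
    n + n + Fintype.card (AbsEdge M (2 ^ M.size) ⊕ AbsState n S (2 ^ M.size)) ≤
      2 ^ (M.size ^ 2 + 3 * M.size + 2) := by
  have hn : n ≤ 2 ^ (M.size ^ 2 + 3 * M.size) :=
    calc n ≤ M.size := by rw [Machine.size]; omega
      _ ≤ 2 ^ M.size := Nat.lt_two_pow_self.le
      _ ≤ _ := Nat.pow_le_pow_right two_pos (by nlinarith)
  have hV := card_absState_le M
  have hE := card_absEdge_le M
  rw [Fintype.card_sum, pow_add]
  omega

end MonotonicCM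

open MonotonicCM PresburgerZ

theorem mainTheorem5 :
    ∃ p : Polynomial ℕ,
      ∀ (n : ℕ) (S : Type*) [Fintype S] (M : MonotonicCM.Machine n S) (s s' : S),
        ∃ φ : PresburgerZ.Formula (n + n),
          φ.IsExistential ∧
          φ.Defines (M.reachSet s s') ∧
          φ.size ≤ 2 ^ p.eval M.size := by
  classical
  refine ⟨8 * (Polynomial.X ^ 2 + 3 * Polynomial.X + 2) + 52, fun n S _ M s s' => ?_⟩
  have hcard := card_variables_le M
  have hvar := TermDefinable.var hcard
  have hB : 2 ^ M.size < 2 ^ (M.size ^ 2 + 3 * M.size + 2) :=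
    Nat.pow_lt_pow_right one_lt_two (by nlinarith)
  have hguard : ∀ e ∈ M.edges, 2 ^ e.guard.size ≤ 2 ^ M.size := fun e he =>
    Nat.pow_le_pow_right two_pos (Machine.guard_size_le_size he)
  rw [Fintype.card_sum] at hcard
  obtain ⟨φ, hφ, hsize, hholds⟩ := QFDefinable.exists_isExistential (card_variables_le M)
    (P := fun x w => ReachCertificate M _ s s' x (w <| .inl ·) (w <| .inr ·)) <|
    qfDefinable_reachCertificate (m := M.size ^ 2 + 3 * M.size + 2) (by omega) hB (by omega)
      (by omega) (fun _ => hvar _) (fun _ => hvar _) (fun _ => hvar _) s s'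
  refine ⟨φ, hφ, fun x => ?_, hsize.trans_eq ?_⟩
  · rw [hholds, ← exists_reachCertificate_iff hguard]
    exact ⟨fun ⟨w, hw⟩ => ⟨_, _, hw⟩, fun ⟨y, z, hw⟩ => ⟨Sum.elim y z, hw⟩⟩
  · simp only [Polynomial.eval_add, Polynomial.eval_mul, Polynomial.eval_ofNat,
      Polynomial.eval_pow, Polynomial.eval_X]
    ring
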